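/- Let $G$ be a connected, walk-regular finite simple graph (for every length $\ell$, the number of closed walks of length $\ell$ from a vertex to itself is the same for all vertices), whose adjacency matrix has distinct eigenvalues $\theta_0>\theta_1>\cdots>\theta_d$ with multiplicities $m_0,m_1,\ldots,m_d$. Suppose that $d\ge 1$, that the diameter $D$ of $G$ equals $d$, and that $\alpha_{d-1}=r$, where $\alpha_{k}$ denotes the maximum number of vertices of $G$ that are mutually at distance greater than $k$. For $i=0,\ldots,d$ put $\pi_i=\prod_{j\ne i}|\theta_i-\theta_j|$. Then $$m_{2i}\ \ge\ \frac{\pi_0}{\pi_{2i}}\quad (1\le i\le \lfloor d/2\rfloor)\qquad\text{and}\qquad m_{2i-1}\ \ge\ (r-1)\frac{\pi_0}{\pi_{2i-1}}\quad (1\le i\le \lceil d/2\rceil).$$ Moreover, if the mean over all vertices $u$ of the number of vertices at distance $d$ from $u$ equals $r-1$, then equality holds in all of these bounds if and only if $G$ is an $r$-antipodal distance-regular graph. Here a connected graph $G$ is distance-regular if, for any two vertices $u,v$ at distance $\ell$, the number of vertices at distance $i$ from $u$ and at distance $j$ from $v$ depends only on $\ell,i,j$; and a graph of diameter $d$ is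 $r$-antipodal if being at distance $0$ or $d$ is an equivalence relation on its vertices all of whose classes have exactly $r$ elements. -/

import Mathlib

/-- `G` is walk-regular: for every length `l`, the number of closed walks of length `l` from a
vertex to itself does not depend on the vertex. -/
def SimpleGraph.IsWalkRegular {V : Type*} (G : SimpleGraph V) : Prop :=
  ∀ (l : ℕ) (u v : V),
    Nat.card {p : G.Walk u u // p.length = l} = Nat.card {p : G.Walk v v // p.length = l}

/-- `spec G = {θ₀^{m₀}, …, θ_d^{m_d}}`: the distinct eigenvalues of the adjacency matrix of `G`
are `θ₀ > θ₁ > ⋯ > θ_d`, with multiplicities `m₀, …, m_d` (the adjacency matrix is real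
symmetric, so algebraic and geometric multiplicities agree). -/
structure SimpleGraph.HasSpectrum {V : Type*} [Fintype V] [DecidableEq V] (G : SimpleGraph V)
    [DecidableRel G.Adj] {d : ℕ} (θ : Fin (d + 1) → ℝ) (m : Fin (d + 1) → ℕ) : Prop where
  strictAnti : StrictAnti θ
  mult_pos : ∀ i, 0 < m i
  charpoly_eq : (G.adjMatrix ℝ).charpoly = ∏ i, (Polynomial.X - Polynomial.C (θ i)) ^ m i

/-- `π_i = ∏_{j ≠ i} |θ_i - θ_j|`. -/
noncomputable def eigenvalueGapProd {d : ℕ} (θ : Fin (d + 1) → ℝ) (i : Fin (d + 1)) : ℝ :=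
  ∏ j ∈ Finset.univ.erase i, |θ i - θ j|

/-- The `k`-independence number `α_k` of `G`: the maximum number of vertices that are mutually at
distance greater than `k`. -/
noncomputable def SimpleGraph.kIndepNum {V : Type*} (G : SimpleGraph V) (k : ℕ) : ℕ :=
  sSup {c : ℕ | ∃ S : Finset V,
    (∀ u ∈ S, ∀ v ∈ S, u ≠ v → (k : ℕ∞) < G.edist u v) ∧ S.card = c}

/-- The mean, over all vertices `u`, of the number of vertices at distance `l` from `u`. -/
noncomputable def SimpleGraph.meanCardAtDist {V : Type*} [Fintype V] (G : SimpleGraph V)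
    (l : ℕ) : ℝ :=
  (∑ u : V, ((Finset.univ.filter fun v : V => G.dist u v = l).card : ℝ)) / Fintype.card V

/-- `G` is distance-regular: it is connected and, for any two vertices `u`, `v` at distance `l`,
the number of vertices at distance `i` from `u` and at distance `j` from `v` depends only on
`l`, `i` and `j`. -/
def SimpleGraph.IsDistanceRegular {V : Type*} [Fintype V] (G : SimpleGraph V) : Prop :=
  G.Connected ∧ ∀ l i j : ℕ, ∃ p : ℕ, ∀ u v : V, G.dist u v = l →
    (Finset.univ.filter fun w : V => G.dist u w = i ∧ G.dist v w = j).card = p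

/-- `G` is `r`-antipodal: being equal or at distance the diameter is an equivalence relation on
the vertices, all of whose classes have `r` elements. -/
def SimpleGraph.IsAntipodal {V : Type*} (G : SimpleGraph V) (r : ℕ) : Prop :=
  Equivalence (fun u v : V => u = v ∨ G.dist u v = G.diam) ∧
    ∀ u : V, Nat.card {v : V // u = v ∨ G.dist u v = G.diam} = r

/-!
Let `A` be the adjacency matrix, `n` the number of vertices and `E_i` the principal idempotent of
`θ i`, obtained as the Lagrange basis polynomial of `θ i` evaluated at `A`. Everything rests on three
facts about the entries of `E_i`: by walk-regularity its diagonal entries all equal `m_i / n`; `E_0`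
is `J / n`, where `J` is the all-ones matrix, because `G` is connected and regular; and since `E_i`
is a polynomial of degree `d` in `A` with leading coefficient `(-1)^i / π_i`, its entry at a pair of
vertices at distance `d` is `(-1)^i π_0 / (n π_i)` (the number of walks of length `d` between them
being read off from `E_0`). The last is `SimpleGraph.HasSpectrum.aeval_basis_apply_of_dist_eq`.

The bounds express that `E_i` is positive semidefinite: for even `i` it is tested on the difference
of two vertices at distance `d`, for odd `i` on the indicator of `r` vertices mutually at distance
`d`.

In the case of equality, let `P = ∑ c_i E_i` with `c_i = r - 1` for even `i` and `c_i = -1` for odd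
`i`. The entries above show that `P` is `1` at distance `d` and that its squared Frobenius norm is
`n (r - 1)`, which is the number of ordered pairs at distance `d`. Hence `P` is the distance-`d`
matrix `A_d` (`SimpleGraph.HasSpectrum.aeval_interpolate_eq_distMatrix`). Its eigenvalues give
`(A_d + I)² = r (A_d + I)`, which says that `G` is `r`-antipodal. Moreover `A_d` is an invertible
polynomial in `A`; a dimension count then yields, for each `k ≤ d`, a nonzero polynomial in `A`
supported at distance exactly `k`. These form a basis of the adjacency algebra, and the expansion of
`J` shows that they are multiples of the distance matrices, so `G` is distance-regular
(`SimpleGraph.HasSpectrum.isDistanceRegular_of_aeval_eq_distMatrix`).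

Conversely, if `G` is distance-regular and `r`-antipodal, then `A_d = p(A)` for a polynomial `p`, the
values `p(θ i)` are `r - 1` or `-1`, and the trace of `E_i A_d` gives
`m_i p(θ i) = (-1)^i (r - 1) π_0 / π_i`, whose sign decides between the two values.
-/

/-! ### Polynomials in a symmetric matrix and the spectrum -/

open Polynomial in
theorem Matrix.aeval_diagonal {n : Type*} [Fintype n] [DecidableEq n] (p : ℝ[X]) (f : n → ℝ) :
    aeval (Matrix.diagonal f) p = Matrix.diagonal fun i => p.eval (f i) := by
  have h := aeval_algHom_apply (Matrix.diagonalAlgHom (n := n) (α := ℝ) ℝ) f p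
  rw [Matrix.diagonalAlgHom_apply, Matrix.diagonalAlgHom_apply] at h
  rw [h]
  congr 1
  funext i
  simp

open Polynomial in
theorem Matrix.IsHermitian.aeval_eq_conj {n : Type*} [Fintype n] [DecidableEq n]
    {A : Matrix n n ℝ} (hA : A.IsHermitian) (p : ℝ[X]) :
    aeval A p = Unitary.conjStarAlgAut ℝ _ hA.eigenvectorUnitary
      (Matrix.diagonal fun i => p.eval (hA.eigenvalues i)) := by
  conv_lhs => rw [hA.spectral_theorem]
  rw [← Matrix.aeval_diagonal p]
  exact aeval_algHom_apply
    ((Unitary.conjStarAlgAut ℝ _ hA.eigenvectorUnitary).toAlgEquiv.toAlgHom) _ p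

open Polynomial in
/-- The trace of `p(A)` is the sum of `p` over the eigenvalues of `A`, with multiplicity. -/
theorem Matrix.IsHermitian.trace_aeval {n : Type*} [Fintype n] [DecidableEq n]
    {A : Matrix n n ℝ} (hA : A.IsHermitian) (p : ℝ[X]) :
    (aeval A p).trace = (A.charpoly.roots.map p.eval).sum := by
  rw [hA.aeval_eq_conj, Unitary.conjStarAlgAut_apply, Matrix.trace_mul_comm, ← mul_assoc,
    hA.roots_charpoly_eq_eigenvalues]
  simp [Matrix.trace_diagonal]

open Polynomial in
theorem Matrix.IsHermitian.aeval_eq_zero {n : Type*} [Fintype n] [DecidableEq n]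
    {A : Matrix n n ℝ} (hA : A.IsHermitian) {p : ℝ[X]} (hp : ∀ x ∈ A.charpoly.roots, p.eval x = 0) :
    aeval A p = 0 := by
  rw [hA.aeval_eq_conj]
  have : (fun i => p.eval (hA.eigenvalues i)) = fun _ => 0 := by
    funext i
    apply hp
    rw [hA.roots_charpoly_eq_eigenvalues]
    simp
  rw [this]; simp

namespace SimpleGraph.HasSpectrum
open Polynomial

variable {V : Type*} [Fintype V] [DecidableEq V] {G : SimpleGraph V} [DecidableRel G.Adj] {d : ℕ}
  {θ : Fin (d + 1) → ℝ} {m : Fin (d + 1) → ℕ}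

theorem roots_charpoly (h : G.HasSpectrum θ m) :
    (G.adjMatrix ℝ).charpoly.roots = ∑ i, m i • {θ i} := by
  rw [h.charpoly_eq, Polynomial.roots_prod]
  · simp [Multiset.bind, Multiset.join, Finset.sum]
  · simp [Finset.prod_ne_zero_iff, X_sub_C_ne_zero]

theorem trace_aeval (h : G.HasSpectrum θ m) (p : ℝ[X]) :
    (aeval (G.adjMatrix ℝ) p).trace = ∑ i, m i * p.eval (θ i) := by
  rw [Matrix.IsHermitian.trace_aeval (SimpleGraph.isHermitian_adjMatrix ℝ G), h.roots_charpoly]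
  rw [← Multiset.coe_mapAddMonoidHom, map_sum, ← Multiset.coe_sumAddMonoidHom, map_sum]
  simp [Multiset.map_nsmul, Multiset.sum_nsmul]

theorem aeval_eq_zero (h : G.HasSpectrum θ m) {p : ℝ[X]} (hp : ∀ i, p.eval (θ i) = 0) :
    aeval (G.adjMatrix ℝ) p = 0 := by
  apply Matrix.IsHermitian.aeval_eq_zero (SimpleGraph.isHermitian_adjMatrix ℝ G)
  intro x hx
  rw [h.roots_charpoly, Multiset.mem_sum] at hx
  obtain ⟨i, -, hi⟩ := hx
  rw [Multiset.mem_nsmul] at hi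
  rw [Multiset.mem_singleton.mp hi.2, hp i]

theorem aeval_congr (h : G.HasSpectrum θ m) {p q : ℝ[X]} (hpq : ∀ i, p.eval (θ i) = q.eval (θ i)) :
    aeval (G.adjMatrix ℝ) p = aeval (G.adjMatrix ℝ) q := by
  rw [← sub_eq_zero, ← map_sub]
  exact h.aeval_eq_zero fun i => by simp [hpq i]

/-- A polynomial is determined on the spectrum by its value at the adjacency matrix: the trace of
`(p - q)(A)²` is a sum of squares with positive weights. -/
theorem eval_eq_of_aeval_eq (h : G.HasSpectrum θ m) {p q : ℝ[X]}
    (hpq : aeval (G.adjMatrix ℝ) p = aeval (G.adjMatrix ℝ) q) (i : Fin (d + 1)) :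
    p.eval (θ i) = q.eval (θ i) := by
  have h1 := h.trace_aeval ((p - q) ^ 2)
  rw [map_pow, map_sub, hpq, sub_self, zero_pow two_ne_zero, Matrix.trace_zero] at h1
  have h2 := (Finset.sum_eq_zero_iff_of_nonneg (fun i _ => by simp only [eval_pow]; positivity)).mp
    h1.symm i (Finset.mem_univ i)
  have h3 : (m i : ℝ) ≠ 0 := by exact_mod_cast (h.mult_pos i).ne'
  simpa [h3, sub_eq_zero] using h2

theorem injOn (h : G.HasSpectrum θ m) : Set.InjOn θ (Finset.univ : Finset (Fin (d + 1))) :=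
  h.strictAnti.injective.injOn

theorem trace_aeval_basis_mul (h : G.HasSpectrum θ m) (i : Fin (d + 1)) (p : ℝ[X]) :
    (aeval (G.adjMatrix ℝ) (Lagrange.basis Finset.univ θ i * p)).trace = m i * p.eval (θ i) := by
  rw [h.trace_aeval, Finset.sum_eq_single i]
  · simp [Lagrange.eval_basis_self h.injOn]
  · intro j _ hj
    simp [Lagrange.eval_basis_of_ne hj.symm]
  · simp

theorem trace_aeval_basis (h : G.HasSpectrum θ m) (i : Fin (d + 1)) :
    (aeval (G.adjMatrix ℝ) (Lagrange.basis Finset.univ θ i)).trace = m i := by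
  simpa using h.trace_aeval_basis_mul i 1

/-- The principal idempotents: `aeval A (Lagrange.basis univ θ i)` is the orthogonal projection onto
the eigenspace of `θ i`. -/
theorem aeval_basis_mul_self (h : G.HasSpectrum θ m) (i : Fin (d + 1)) :
    aeval (G.adjMatrix ℝ) (Lagrange.basis Finset.univ θ i) *
      aeval (G.adjMatrix ℝ) (Lagrange.basis Finset.univ θ i) =
      aeval (G.adjMatrix ℝ) (Lagrange.basis Finset.univ θ i) := by
  rw [← map_mul]
  apply h.aeval_congr
  intro j
  rcases eq_or_ne i j with rfl | hij
  · simp [Lagrange.eval_basis_self h.injOn]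
  · simp [Lagrange.eval_basis_of_ne hij]

theorem adjMatrix_mul_aeval_basis (h : G.HasSpectrum θ m) (i : Fin (d + 1)) :
    G.adjMatrix ℝ * aeval (G.adjMatrix ℝ) (Lagrange.basis Finset.univ θ i) =
      θ i • aeval (G.adjMatrix ℝ) (Lagrange.basis Finset.univ θ i) := by
  have : aeval (G.adjMatrix ℝ) (X * Lagrange.basis Finset.univ θ i) =
      aeval (G.adjMatrix ℝ) (C (θ i) * Lagrange.basis Finset.univ θ i) := by
    apply h.aeval_congr
    intro j
    rcases eq_or_ne i j with rfl | hij
    · simp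
    · simp [Lagrange.eval_basis_of_ne hij]
  simpa [Algebra.smul_def] using this

end SimpleGraph.HasSpectrum

namespace SimpleGraph
open Polynomial
variable {V : Type*} [Fintype V] [DecidableEq V] {G : SimpleGraph V} [DecidableRel G.Adj]

theorem aeval_adjMatrix_comm (p : ℝ[X]) (u v : V) :
    aeval (G.adjMatrix ℝ) p u v = aeval (G.adjMatrix ℝ) p v u := by
  have h : (aeval (G.adjMatrix ℝ) p).IsSymm := by
    induction p using Polynomial.induction_on' with
    | add p q hp hq => rw [map_add]; exact hp.add hq
    | monomial n a =>
      rw [aeval_monomial, ← Algebra.smul_def]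
      exact (G.isSymm_adjMatrix.pow n).smul a
  exact (h.apply v u)

/-- The quadratic form of an idempotent polynomial in the adjacency matrix is nonnegative. -/
theorem sum_sum_aeval_nonneg {p : ℝ[X]}
    (hp : aeval (G.adjMatrix ℝ) p * aeval (G.adjMatrix ℝ) p = aeval (G.adjMatrix ℝ) p) (x : V → ℝ) :
    0 ≤ ∑ u, ∑ v, x u * x v * aeval (G.adjMatrix ℝ) p u v := by
  set E := aeval (G.adjMatrix ℝ) p with hE
  have : ∑ u, ∑ v, x u * x v * E u v = ∑ w, (∑ u, E w u * x u) ^ 2 := by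
    conv_lhs => rw [← hp]
    simp only [Matrix.mul_apply, Finset.mul_sum]
    calc _ = ∑ u, ∑ w, ∑ v, x u * x v * (E u w * E w v) :=
          Finset.sum_congr rfl fun u _ => Finset.sum_comm
      _ = ∑ w, ∑ u, ∑ v, x u * x v * (E u w * E w v) := Finset.sum_comm
      _ = _ := by
        refine Finset.sum_congr rfl fun w _ => ?_
        rw [sq, Finset.sum_mul_sum]
        refine Finset.sum_congr rfl fun u _ => Finset.sum_congr rfl fun v _ => ?_
        rw [hE, aeval_adjMatrix_comm p u w]
        ring
  rw [this]
  positivity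

end SimpleGraph

/-! ### Entries of the principal idempotents and the bounds -/

/-- As `θ` is decreasing, exactly the `i` factors with `j < i` are negative. -/
theorem prod_sub_eq_neg_one_pow_mul_eigenvalueGapProd {d : ℕ} {θ : Fin (d + 1) → ℝ}
    (hθ : StrictAnti θ) (i : Fin (d + 1)) :
    ∏ j ∈ Finset.univ.erase i, (θ i - θ j) = (-1) ^ (i : ℕ) * eigenvalueGapProd θ i := by
  have h : ∀ j ∈ Finset.univ.erase i, θ i - θ j = (if j < i then -1 else 1) * |θ i - θ j| := by
    intro j hj
    rcases lt_or_gt_of_ne (Finset.ne_of_mem_erase hj) with hji | hij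
    · rw [if_pos hji, abs_of_neg (sub_neg.mpr (hθ hji))]; ring
    · rw [if_neg hij.not_gt, abs_of_pos (sub_pos.mpr (hθ hij)), one_mul]
  have hf : (Finset.univ.erase i).filter (· < i) = Finset.Iio i := by
    ext j; simp; exact fun h => h.ne
  rw [Finset.prod_congr rfl h, Finset.prod_mul_distrib, Finset.prod_ite, hf]
  simp [eigenvalueGapProd]

theorem eigenvalueGapProd_pos {d : ℕ} {θ : Fin (d + 1) → ℝ} (hθ : StrictAnti θ)
    (i : Fin (d + 1)) : 0 < eigenvalueGapProd θ i :=
  Finset.prod_pos fun _ hj => abs_pos.mpr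
    (sub_ne_zero.mpr (hθ.injective.ne (Finset.ne_of_mem_erase hj).symm))

namespace SimpleGraph
open Polynomial
variable {V : Type*} [Fintype V] [DecidableEq V] {G : SimpleGraph V} [DecidableRel G.Adj]

theorem adjMatrix_pow_apply_eq_zero_of_lt_dist {l : ℕ} {u v : V} (h : l < G.dist u v) :
    (G.adjMatrix ℝ ^ l) u v = 0 := by
  rw [adjMatrix_pow_apply_eq_card_walk, Nat.cast_eq_zero, Fintype.card_eq_zero_iff]
  exact ⟨fun p => by
    have h1 := SimpleGraph.dist_le p.1
    have h2 : p.1.length = l := p.2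
    omega⟩

/-- At a pair of vertices at distance at least `natDegree p`, only the coefficient of `p` in degree
equal to that distance contributes to the entry of `p(A)`, since no shorter walks exist. -/
theorem aeval_apply_of_natDegree_le {p : ℝ[X]} {u v : V} (h : p.natDegree ≤ G.dist u v) :
    aeval (G.adjMatrix ℝ) p u v = p.coeff (G.dist u v) * (G.adjMatrix ℝ ^ G.dist u v) u v := by
  rw [aeval_eq_sum_range' (Nat.lt_succ_of_le h), Matrix.sum_apply, Finset.sum_range_succ,
    Finset.sum_eq_zero, zero_add]
  · simp
  · intro l hl
    rw [Matrix.smul_apply, adjMatrix_pow_apply_eq_zero_of_lt_dist (Finset.mem_range.mp hl),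
      smul_zero]

theorem aeval_apply_eq_zero_of_natDegree_lt {p : ℝ[X]} {u v : V} (h : p.natDegree < G.dist u v) :
    aeval (G.adjMatrix ℝ) p u v = 0 := by
  rw [aeval_apply_of_natDegree_le h.le, coeff_eq_zero_of_natDegree_lt h, zero_mul]

/-- Walk-regularity says that every polynomial in the adjacency matrix has constant diagonal. -/
theorem IsWalkRegular.aeval_apply_self (hw : G.IsWalkRegular) (p : ℝ[X]) (u : V) :
    aeval (G.adjMatrix ℝ) p u u = (aeval (G.adjMatrix ℝ) p).trace / Fintype.card V := by
  have hpow : ∀ (l : ℕ) (u v : V), (G.adjMatrix ℝ ^ l) u u = (G.adjMatrix ℝ ^ l) v v := by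
    intro l u v
    have := hw l u v
    rw [Nat.card_eq_fintype_card, Nat.card_eq_fintype_card] at this
    rw [adjMatrix_pow_apply_eq_card_walk, adjMatrix_pow_apply_eq_card_walk, Nat.cast_inj]
    convert this using 1 <;> exact Fintype.card_congr (Equiv.refl _)
  have hp : ∀ v, aeval (G.adjMatrix ℝ) p v v = aeval (G.adjMatrix ℝ) p u u := by
    intro v
    simp only [aeval_eq_sum_range, Matrix.sum_apply, Matrix.smul_apply, hpow _ v u]
  have : (Fintype.card V : ℝ) ≠ 0 := by
    have : Nonempty V := ⟨u⟩
    simp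
  rw [Matrix.trace, eq_div_iff this]
  simp [hp, mul_comm]

theorem IsWalkRegular.degree_eq (hw : G.IsWalkRegular) (u v : V) : G.degree u = G.degree v := by
  have h1 := (hw.aeval_apply_self (X ^ 2) u).trans (hw.aeval_apply_self (X ^ 2) v).symm
  rw [map_pow, aeval_X, sq, adjMatrix_mul_self_apply_self, adjMatrix_mul_self_apply_self] at h1
  exact_mod_cast h1

namespace HasSpectrum
variable {d : ℕ} {θ : Fin (d + 1) → ℝ} {m : Fin (d + 1) → ℕ}

theorem exists_eq_of_mulVec_eq_smul (h : G.HasSpectrum θ m) {x : V → ℝ} (hx : x ≠ 0) {k : ℝ}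
    (hk : (G.adjMatrix ℝ).mulVec x = k • x) : ∃ i, θ i = k := by
  have hp : ∀ p : ℝ[X], (aeval (G.adjMatrix ℝ) p).mulVec x = p.eval k • x := by
    intro p
    induction p using Polynomial.induction_on with
    | C a => simp [Algebra.algebraMap_eq_smul_one, Matrix.smul_mulVec]
    | add p q hp hq => simp [Matrix.add_mulVec, hp, hq, add_smul]
    | monomial n a ih =>
      rw [pow_succ, ← mul_assoc, map_mul, aeval_X, ← Matrix.mulVec_mulVec, hk, Matrix.mulVec_smul,
        ih, smul_smul, eval_mul (q := X), eval_X, mul_comm]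
  -- This polynomial annihilates the adjacency matrix, so it vanishes at `k`.
  have h0 := hp (∏ i, (X - C (θ i)))
  rw [h.aeval_eq_zero fun i => by
    rw [eval_prod]; exact Finset.prod_eq_zero (Finset.mem_univ i) (by simp)] at h0
  rw [Matrix.zero_mulVec, eq_comm, smul_eq_zero, or_iff_left hx, eval_prod,
    Finset.prod_eq_zero_iff] at h0
  obtain ⟨i, -, hi⟩ := h0
  exact ⟨i, by simpa [sub_eq_zero, eq_comm] using hi⟩

/-- In a connected regular graph, the principal idempotent of the
largest eigenvalue is `J / n`. -/
theorem aeval_basis_zero_apply (h : G.HasSpectrum θ m) (hconn : G.Connected)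
    (hreg : ∀ u v : V, G.degree u = G.degree v) (u v : V) :
    aeval (G.adjMatrix ℝ) (Lagrange.basis Finset.univ θ 0) u v = 1 / Fintype.card V := by
  set E := aeval (G.adjMatrix ℝ) (Lagrange.basis Finset.univ θ 0) with hE
  have hcard : (Fintype.card V : ℝ) ≠ 0 := by
    have : Nonempty V := ⟨u⟩
    simp
  have hcol : ∀ b, (G.adjMatrix ℝ).mulVec (fun a => E a b) = θ 0 • fun a => E a b := by
    intro b
    funext a
    exact congrFun (congrFun (h.adjMatrix_mul_aeval_basis 0) a) b
  have hLap : ∀ b, (G.lapMatrix ℝ).mulVec (fun a => E a b) =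
      ((G.degree u : ℝ) - θ 0) • fun a => E a b := by
    intro b
    funext a
    have := congrFun (hcol b) a
    rw [adjMatrix_mulVec_apply] at this
    rw [lapMatrix_mulVec_apply, this, hreg a u]
    simp [sub_mul]
  have hone : (G.adjMatrix ℝ).mulVec (fun _ => 1) = (G.degree u : ℝ) • fun _ => (1 : ℝ) := by
    funext a
    rw [adjMatrix_mulVec_apply]
    simp [hreg a u]
  -- The largest eigenvalue is at most the degree because the Laplacian is positive semidefinite.
  have hle : θ 0 ≤ G.degree u := by
    have hne : E ≠ 0 := by
      intro h0
      have := h.trace_aeval_basis 0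
      rw [← hE, h0, Matrix.trace_zero] at this
      exact (h.mult_pos 0).ne' (by exact_mod_cast this.symm)
    obtain ⟨a, b, hab⟩ : ∃ a b, E a b ≠ 0 := by
      by_contra! hcon
      exact hne (Matrix.ext hcon)
    have hpsd := (posSemidef_lapMatrix ℝ G).dotProduct_mulVec_nonneg (fun a => E a b)
    rw [hLap, dotProduct_smul, star_trivial, smul_eq_mul] at hpsd
    have hpos : 0 < (fun a => E a b) ⬝ᵥ (fun a => E a b) := by
      refine lt_of_le_of_ne (Finset.sum_nonneg fun c _ => mul_self_nonneg _) fun h0 => hab ?_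
      exact congrFun (dotProduct_self_eq_zero.mp h0.symm) a
    linarith [nonneg_of_mul_nonneg_left hpsd hpos]
  have hθ : θ 0 = G.degree u := by
    obtain ⟨i, hi⟩ := h.exists_eq_of_mulVec_eq_smul (x := fun _ => 1)
      (fun h0 => one_ne_zero (congrFun h0 u)) hone
    exact le_antisymm hle (hi ▸ h.strictAnti.antitone (Fin.zero_le i))
  -- Each column of `E` is in the kernel of the Laplacian of a connected graph.
  have hconst : ∀ a b c, E a b = E c b := by
    intro a b c
    refine (lapMatrix_mulVec_eq_zero_iff_forall_reachable G (x := fun a => E a b)).mp ?_ a c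
      (hconn a c)
    rw [hLap, hθ, sub_self, zero_smul]
  have hconst' : ∀ a b, E a b = E u v := by
    intro a b
    rw [hconst a b v, hE, aeval_adjMatrix_comm, ← hE]
    exact hconst b v u
  have hidem := congrFun (congrFun (h.aeval_basis_mul_self 0) u) v
  rw [← hE, Matrix.mul_apply] at hidem
  simp only [hconst', Finset.sum_const, Finset.card_univ, nsmul_eq_mul] at hidem
  have htr := h.trace_aeval_basis 0
  rw [← hE, Matrix.trace] at htr
  simp only [Matrix.diag, hconst', Finset.sum_const, Finset.card_univ, nsmul_eq_mul] at htr
  have hne : E u v ≠ 0 := by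
    intro h0
    rw [h0, mul_zero] at htr
    exact (h.mult_pos 0).ne' (by exact_mod_cast htr.symm)
  rw [eq_div_iff hcard]
  refine mul_right_cancel₀ hne ?_
  linarith

theorem mult_zero (h : G.HasSpectrum θ m) (hconn : G.Connected)
    (hreg : ∀ u v : V, G.degree u = G.degree v) : m 0 = 1 := by
  have := hconn.nonempty
  have h1 := h.trace_aeval_basis 0
  simp only [Matrix.trace, Matrix.diag, h.aeval_basis_zero_apply hconn hreg] at h1
  simp at h1
  exact_mod_cast h1.symm

theorem natDegree_basis (h : G.HasSpectrum θ m) (i : Fin (d + 1)) :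
    (Lagrange.basis Finset.univ θ i).natDegree = d := by
  rw [Lagrange.natDegree_basis h.injOn (Finset.mem_univ i)]
  simp

theorem coeff_basis (h : G.HasSpectrum θ m) (i : Fin (d + 1)) :
    (Lagrange.basis Finset.univ θ i).coeff d = (-1) ^ (i : ℕ) / eigenvalueGapProd θ i := by
  have := Lagrange.leadingCoeff_basis h.injOn (Finset.mem_univ i)
  rw [leadingCoeff, h.natDegree_basis,
    prod_sub_eq_neg_one_pow_mul_eigenvalueGapProd h.strictAnti] at this
  rw [this, mul_inv, ← inv_pow, inv_neg, inv_one, div_eq_mul_inv]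

/-- The entries of the principal idempotents at pairs of vertices at the maximal possible distance
`d` are determined by the eigenvalues: such an entry of a polynomial in the adjacency matrix only
sees the coefficient of degree `d`, and the idempotent `J / n` gives the number of walks. -/
theorem aeval_basis_apply_of_dist_eq (h : G.HasSpectrum θ m) (hconn : G.Connected)
    (hreg : ∀ u v : V, G.degree u = G.degree v) (i : Fin (d + 1)) {u v : V} (huv : G.dist u v = d) :
    aeval (G.adjMatrix ℝ) (Lagrange.basis Finset.univ θ i) u v =
      (-1) ^ (i : ℕ) * (eigenvalueGapProd θ 0 / eigenvalueGapProd θ i) / Fintype.card V := by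
  have h0 := h.aeval_basis_zero_apply hconn hreg u v
  rw [aeval_apply_of_natDegree_le (by rw [h.natDegree_basis, huv]), huv, h.coeff_basis] at h0 ⊢
  have p0 := eigenvalueGapProd_pos h.strictAnti 0
  have hA : (G.adjMatrix ℝ ^ d) u v = eigenvalueGapProd θ 0 / Fintype.card V := by
    rw [Fin.val_zero, pow_zero, div_mul_eq_mul_div, one_mul, div_eq_iff p0.ne'] at h0
    rw [h0]; ring
  rw [hA]; ring

theorem aeval_basis_apply_self (h : G.HasSpectrum θ m) (hw : G.IsWalkRegular) (i : Fin (d + 1))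
    (u : V) : aeval (G.adjMatrix ℝ) (Lagrange.basis Finset.univ θ i) u u =
      m i / Fintype.card V := by
  rw [hw.aeval_apply_self, h.trace_aeval_basis]

/-- The bound at even indices tests positive semidefiniteness of the principal idempotent on the
difference of the indicators of two vertices at distance `d`. -/
theorem div_le_mult_of_even (h : G.HasSpectrum θ m) (hconn : G.Connected) (hw : G.IsWalkRegular)
    (hd : 1 ≤ d) {u v : V} (huv : G.dist u v = d) {i : Fin (d + 1)} (hi : Even (i : ℕ)) :
    eigenvalueGapProd θ 0 / eigenvalueGapProd θ i ≤ m i := by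
  have hcard : (0 : ℝ) < Fintype.card V := by
    have : Nonempty V := ⟨u⟩
    positivity
  have hne : u ≠ v := by rintro rfl; simp at huv; omega
  have hq := sum_sum_aeval_nonneg (h.aeval_basis_mul_self i) (Pi.single u 1 - Pi.single v 1)
  have huv' := h.aeval_basis_apply_of_dist_eq hconn hw.degree_eq i huv
  have hvu' := h.aeval_basis_apply_of_dist_eq hconn hw.degree_eq i (dist_comm.trans huv)
  simp only [Pi.sub_apply, Pi.single_apply, sub_mul, mul_sub, Finset.sum_sub_distrib, ite_mul,
    mul_ite, mul_one, mul_zero, one_mul, zero_mul, Finset.sum_ite_eq',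
    Finset.mem_univ, if_true, h.aeval_basis_apply_self hw, huv', hvu', hi.neg_one_pow] at hq
  simp at hq
  have h2 : eigenvalueGapProd θ 0 / eigenvalueGapProd θ i / Fintype.card V ≤
      m i / Fintype.card V := by linarith
  exact (div_le_div_iff_of_pos_right hcard).mp h2

/-- The bound at odd indices tests positive semidefiniteness of the principal idempotent on the
indicator of a set of vertices mutually at distance `d`. -/
theorem mul_div_le_mult_of_odd (h : G.HasSpectrum θ m) (hconn : G.Connected) (hw : G.IsWalkRegular)
    {S : Finset V} (hS : ∀ u ∈ S, ∀ v ∈ S, u ≠ v → G.dist u v = d) (hne : S.Nonempty)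
    {i : Fin (d + 1)} (hi : Odd (i : ℕ)) :
    ((S.card : ℝ) - 1) * (eigenvalueGapProd θ 0 / eigenvalueGapProd θ i) ≤ m i := by
  have hcard : (0 : ℝ) < Fintype.card V := by
    have : Nonempty V := ⟨hne.choose⟩
    positivity
  have hS0 : (0 : ℝ) < S.card := by exact_mod_cast hne.card_pos
  have hq := sum_sum_aeval_nonneg (h.aeval_basis_mul_self i) (fun u => if u ∈ S then 1 else 0)
  set b := eigenvalueGapProd θ 0 / eigenvalueGapProd θ i
  have hrow : ∀ u ∈ S, ∑ v ∈ S, aeval (G.adjMatrix ℝ) (Lagrange.basis Finset.univ θ i) u v =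
      m i / Fintype.card V - (S.card - 1) * (b / Fintype.card V) := by
    intro u hu
    rw [← Finset.add_sum_erase S _ hu, h.aeval_basis_apply_self hw,
      Finset.sum_congr rfl fun v hv => h.aeval_basis_apply_of_dist_eq hconn hw.degree_eq i
        (hS u hu v (Finset.mem_of_mem_erase hv) (Finset.ne_of_mem_erase hv).symm),
      Finset.sum_const, Finset.card_erase_of_mem hu, hi.neg_one_pow, nsmul_eq_mul,
      Nat.cast_pred hne.card_pos]
    ring
  have hq' : 0 ≤ ∑ u ∈ S, ∑ v ∈ S,
      aeval (G.adjMatrix ℝ) (Lagrange.basis Finset.univ θ i) u v := by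
    refine hq.trans_eq ?_
    have : ∀ u, (∑ v, (if u ∈ S then (1 : ℝ) else 0) * (if v ∈ S then 1 else 0) *
        aeval (G.adjMatrix ℝ) (Lagrange.basis Finset.univ θ i) u v) =
        if u ∈ S then ∑ v ∈ S, aeval (G.adjMatrix ℝ) (Lagrange.basis Finset.univ θ i) u v else 0 := by
      intro u
      split_ifs <;> simp [Finset.sum_ite_mem]
    rw [Finset.sum_congr rfl fun u _ => this u, Finset.sum_ite_mem, Finset.univ_inter]
  rw [Finset.sum_congr rfl hrow, Finset.sum_const, nsmul_eq_mul] at hq'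
  have h2 := nonneg_of_mul_nonneg_right hq' hS0
  have h3 : ((S.card : ℝ) - 1) * b / Fintype.card V ≤ m i / Fintype.card V := by
    rw [mul_div_assoc]; linarith
  exact (div_le_div_iff_of_pos_right hcard).mp h3

end HasSpectrum

end SimpleGraph

/-- A largest set of vertices mutually at distance greater than `d - 1` in a graph of diameter `d`
has its vertices mutually at distance exactly `d`, and contains at least two of them. -/
theorem SimpleGraph.exists_finset_dist_eq_of_kIndepNum {V : Type*} [Fintype V]
    {G : SimpleGraph V} (hconn : G.Connected) {d : ℕ} (hd : 1 ≤ d)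
    (hdiam : G.diam = d) :
    ∃ S : Finset V, (∀ u ∈ S, ∀ v ∈ S, u ≠ v → G.dist u v = d) ∧
      S.card = G.kIndepNum (d - 1) ∧ 2 ≤ S.card := by
  classical
  have := hconn.nonempty
  set T := {c : ℕ | ∃ S : Finset V,
    (∀ u ∈ S, ∀ v ∈ S, u ≠ v → ((d - 1 : ℕ) : ℕ∞) < G.edist u v) ∧ S.card = c} with hT
  have hbdd : BddAbove T := ⟨Fintype.card V, by rintro _ ⟨S, -, rfl⟩; exact S.card_le_univ⟩
  have hed : ∀ u v, ((d - 1 : ℕ) : ℕ∞) < G.edist u v ↔ d ≤ G.dist u v := by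
    intro u v
    rw [← (hconn u v).coe_dist_eq_edist, Nat.cast_lt]
    omega
  obtain ⟨a, b, hab⟩ := G.exists_dist_eq_diam
  rw [hdiam] at hab
  have hne : a ≠ b := by rintro rfl; simp at hab; omega
  have h2 : 2 ∈ T := by
    refine ⟨{a, b}, ?_, Finset.card_pair hne⟩
    intro u hu v hv huv
    rw [hed]
    simp only [Finset.mem_insert, Finset.mem_singleton] at hu hv
    rcases hu with rfl | rfl <;> rcases hv with rfl | rfl
    · exact absurd rfl huv
    · exact hab.ge
    · rw [SimpleGraph.dist_comm]; exact hab.ge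
    · exact absurd rfl huv
  obtain ⟨S, hS, hSc⟩ := Nat.sSup_mem ⟨2, h2⟩ hbdd
  refine ⟨S, fun u hu v hv huv => le_antisymm ?_ ((hed u v).mp (hS u hu v hv huv)), hSc, ?_⟩
  · rw [← hdiam]
    refine SimpleGraph.dist_le_diam fun htop => ?_
    rw [SimpleGraph.diam, htop, ENat.toNat_top] at hdiam
    omega
  · rw [hSc]; exact le_csSup hbdd h2

/-! ### Distance-regularity from the distance-`d` matrix -/

open Polynomial in
theorem natDegree_le_of_mem_degreeLT {n : ℕ} {p : ℝ[X]} (hp : p ∈ degreeLT ℝ (n + 1)) :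
    p.natDegree ≤ n := by
  rcases eq_or_ne p 0 with rfl | h0
  · simp
  · rw [mem_degreeLT, degree_eq_natDegree h0] at hp
    exact Nat.lt_succ_iff.mp (by exact_mod_cast hp)

open Polynomial in
/-- Inside the `(d + 1)`-dimensional space of functions on the nodes, the polynomials of degree at
most `k` and the multiples by `c` of those of degree at most `d - k` have dimensions adding up to
`d + 2`, so they intersect nontrivially. -/
theorem exists_natDegree_le_eval_eq_mul_eval {d : ℕ} {θ : Fin (d + 1) → ℝ}
    (hθ : Function.Injective θ) {c : Fin (d + 1) → ℝ} (hc : ∀ i, c i ≠ 0) {k : ℕ} (hk : k ≤ d) :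
    ∃ p q : ℝ[X], p.natDegree ≤ k ∧ q.natDegree ≤ d - k ∧ (∃ i, p.eval (θ i) ≠ 0) ∧
      ∀ i, p.eval (θ i) = c i * q.eval (θ i) := by
  let ev (n : ℕ) : degreeLT ℝ n →ₗ[ℝ] (Fin (d + 1) → ℝ) :=
    (LinearMap.pi fun i => leval (θ i)) ∘ₗ (degreeLT ℝ n).subtype
  have hev : ∀ n (p : degreeLT ℝ n) i, ev n p i = (p : ℝ[X]).eval (θ i) := fun _ _ _ => rfl
  let L : (degreeLT ℝ (k + 1) × degreeLT ℝ (d - k + 1)) →ₗ[ℝ] (Fin (d + 1) → ℝ) :=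
    (ev (k + 1)).coprod (-(LinearMap.pi fun i => c i • LinearMap.proj i) ∘ₗ ev (d - k + 1))
  have : Module.Finite ℝ (degreeLT ℝ (k + 1)) := Module.Finite.equiv (degreeLTEquiv ℝ (k + 1)).symm
  have : Module.Finite ℝ (degreeLT ℝ (d - k + 1)) :=
    Module.Finite.equiv (degreeLTEquiv ℝ (d - k + 1)).symm
  have hker : LinearMap.ker L ≠ ⊥ := by
    apply LinearMap.ker_ne_bot_of_finrank_lt
    rw [Module.finrank_prod, (degreeLTEquiv ℝ (k + 1)).finrank_eq,
      (degreeLTEquiv ℝ (d - k + 1)).finrank_eq]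
    simp only [Module.finrank_fintype_fun_eq_card, Fintype.card_fin]
    omega
  obtain ⟨⟨p, q⟩, hpq, hne⟩ := Submodule.exists_mem_ne_zero_of_ne_bot hker
  have heq : ∀ i, (p : ℝ[X]).eval (θ i) = c i * (q : ℝ[X]).eval (θ i) := by
    intro i
    have h1 := congrFun (LinearMap.mem_ker.mp hpq) i
    simp only [L, LinearMap.coprod_apply, Pi.add_apply, LinearMap.comp_apply, LinearMap.neg_apply,
      Pi.neg_apply, LinearMap.pi_apply, LinearMap.smul_apply, LinearMap.proj_apply, smul_eq_mul,
      Pi.zero_apply, hev] at h1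
    linarith
  have hzero : ∀ {n : ℕ} (s : degreeLT ℝ n), n ≤ d + 1 →
      (∀ i, (s : ℝ[X]).eval (θ i) = 0) → s = 0 := by
    intro n s hn hs
    refine Subtype.ext (eq_zero_of_degree_lt_of_eval_index_eq_zero (s := Finset.univ) hθ.injOn
      ((mem_degreeLT.mp s.2).trans_le ?_) fun i _ => hs i)
    rw [Finset.card_univ, Fintype.card_fin]
    exact_mod_cast hn
  refine ⟨p, q, ?_, ?_, ?_, heq⟩
  · exact natDegree_le_of_mem_degreeLT p.2
  · exact natDegree_le_of_mem_degreeLT q.2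
  · by_contra! hcon
    refine hne (Prod.ext (hzero p (by omega) hcon) (hzero q (by omega) fun i => ?_))
    have := heq i
    rw [hcon i, eq_comm, mul_eq_zero] at this
    exact this.resolve_left (hc i)

namespace SimpleGraph
open Polynomial

/-- The distance-`l` matrix of `G`: its `(u, v)` entry is `1` if `u` and `v` are at distance `l`,
and `0` otherwise. -/
noncomputable def distMatrix {V : Type*} (G : SimpleGraph V) (l : ℕ) : Matrix V V ℝ :=
  Matrix.of fun u v => if G.dist u v = l then 1 else 0

theorem distMatrix_apply {V : Type*} (G : SimpleGraph V) (l : ℕ) (u v : V) :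
    G.distMatrix l u v = if G.dist u v = l then 1 else 0 := rfl

theorem distMatrix_mul_distMatrix_apply {V : Type*} [Fintype V] (G : SimpleGraph V) (i j : ℕ)
    (u v : V) : (G.distMatrix i * G.distMatrix j) u v =
      (Finset.univ.filter fun w : V => G.dist u w = i ∧ G.dist v w = j).card := by
  simp only [Matrix.mul_apply, distMatrix_apply, mul_ite, mul_one, mul_zero, ← ite_and,
    G.dist_comm (v := v)]
  rw [Finset.sum_boole]
  simp only [and_comm]

variable {V : Type*} [Fintype V] [DecidableEq V] {G : SimpleGraph V} [DecidableRel G.Adj]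

/-- A connected graph is distance-regular if the polynomials in its adjacency matrix are exactly the
matrices whose entries depend only on the distance. -/
theorem isDistanceRegular_of_aeval {d : ℕ} (hconn : G.Connected)
    (hdist : ∀ u v, G.dist u v ≤ d)
    (hdep : ∀ p : ℝ[X], ∃ g : ℕ → ℝ, ∀ u v, aeval (G.adjMatrix ℝ) p u v = g (G.dist u v))
    (hmem : ∀ k ≤ d, ∃ p : ℝ[X], aeval (G.adjMatrix ℝ) p = G.distMatrix k) :
    G.IsDistanceRegular := by
  refine ⟨hconn, fun l i j => ?_⟩
  by_cases hij : i ≤ d ∧ j ≤ d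
  · obtain ⟨p, hp⟩ := hmem i hij.1
    obtain ⟨q, hq⟩ := hmem j hij.2
    obtain ⟨g, hg⟩ := hdep (p * q)
    simp only [map_mul, hp, hq, distMatrix_mul_distMatrix_apply] at hg
    by_cases hl : ∃ u v, G.dist u v = l
    · obtain ⟨a, b, hab⟩ := hl
      refine ⟨(Finset.univ.filter fun w : V => G.dist a w = i ∧ G.dist b w = j).card,
        fun u v huv => ?_⟩
      have := (hg u v).trans ((congrArg g (huv.trans hab.symm)).trans (hg a b).symm)
      exact_mod_cast this
    · exact ⟨0, fun u v huv => absurd ⟨u, v, huv⟩ hl⟩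
  · refine ⟨0, fun u v _ => ?_⟩
    rw [Finset.card_eq_zero, Finset.filter_eq_empty_iff]
    rintro w - ⟨h1, h2⟩
    exact hij ⟨h1 ▸ hdist u w, h2 ▸ hdist v w⟩

namespace HasSpectrum
variable {d : ℕ} {θ : Fin (d + 1) → ℝ} {m : Fin (d + 1) → ℕ}

/-- If `A_d = s(A)` is invertible, then for every `k ≤ d` there is a nonzero polynomial in the
adjacency matrix supported on the pairs at distance exactly `k`: take a common element of the
polynomials of degree at most `k`, which vanish at distance greater than `k`, and of the products
`q(A) * A_d` with `q` of degree at most `d - k`, which vanish at distance less than `k`. -/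
theorem exists_aeval_supported (h : G.HasSpectrum θ m) (hconn : G.Connected)
    {s : ℝ[X]} (hs : aeval (G.adjMatrix ℝ) s = G.distMatrix d) (hs0 : ∀ i, s.eval (θ i) ≠ 0)
    {k : ℕ} (hk : k ≤ d) :
    ∃ p : ℝ[X], (∃ u v, aeval (G.adjMatrix ℝ) p u v ≠ 0) ∧
      ∀ u v, aeval (G.adjMatrix ℝ) p u v ≠ 0 → G.dist u v = k := by
  obtain ⟨p, q, hp, hq, ⟨i, hi⟩, hpq⟩ :=
    exists_natDegree_le_eval_eq_mul_eval h.strictAnti.injective hs0 hk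
  refine ⟨p, ?_, fun u v huv => le_antisymm ?_ ?_⟩
  · by_contra! hcon
    have : aeval (G.adjMatrix ℝ) p = aeval (G.adjMatrix ℝ) (0 : ℝ[X]) := by
      rw [map_zero]; exact Matrix.ext hcon
    exact hi (by simpa using h.eval_eq_of_aeval_eq this i)
  · by_contra! hlt
    exact huv (aeval_apply_eq_zero_of_natDegree_lt (hp.trans_lt hlt))
  · have hmul : aeval (G.adjMatrix ℝ) p = aeval (G.adjMatrix ℝ) q * G.distMatrix d := by
      rw [← hs, ← map_mul]
      exact h.aeval_congr fun i => by rw [hpq i, eval_mul, mul_comm]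
    rw [hmul, Matrix.mul_apply] at huv
    obtain ⟨w, -, hw⟩ := Finset.exists_ne_zero_of_sum_ne_zero huv
    have h1 : G.dist u w ≤ d - k := by
      by_contra! hlt
      exact left_ne_zero_of_mul hw (aeval_apply_eq_zero_of_natDegree_lt (hq.trans_lt hlt))
    have h2 : G.dist w v = d := by
      have := right_ne_zero_of_mul hw
      rw [distMatrix_apply] at this
      exact (ite_ne_right_iff.mp this).1
    have h3 := hconn.dist_triangle (u := w) (v := u) (w := v)
    have h4 := G.dist_comm (u := w) (v := u)
    omega

/-- If `A_d` is an invertible polynomial in the adjacency matrix, then `G` is distance-regular: the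
polynomials supported on single distances form a basis of the adjacency algebra, and expanding the
all-ones matrix in this basis shows that each of them is a multiple of a distance matrix. -/
theorem isDistanceRegular_of_aeval_eq_distMatrix (h : G.HasSpectrum θ m) (hconn : G.Connected)
    (hreg : ∀ u v : V, G.degree u = G.degree v) (hdist : ∀ u v, G.dist u v ≤ d)
    {s : ℝ[X]} (hs : aeval (G.adjMatrix ℝ) s = G.distMatrix d) (hs0 : ∀ i, s.eval (θ i) ≠ 0) :
    G.IsDistanceRegular := by
  have := hconn.nonempty
  choose P hPne hPsupp using fun k : Fin (d + 1) =>
    h.exists_aeval_supported hconn hs hs0 (Nat.lt_succ_iff.mp k.2)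
  have hentry : ∀ (g : Fin (d + 1) → ℝ) (u v : V),
      aeval (G.adjMatrix ℝ) (∑ k, g k • P k) u v =
        g ⟨G.dist u v, Nat.lt_succ_iff.mpr (hdist u v)⟩ *
          aeval (G.adjMatrix ℝ) (P ⟨G.dist u v, Nat.lt_succ_iff.mpr (hdist u v)⟩) u v := by
    intro g u v
    simp only [map_sum, map_smul, Matrix.sum_apply, Matrix.smul_apply, smul_eq_mul]
    refine Finset.sum_eq_single _ (fun k _ hk => ?_) (by simp)
    by_contra hne
    exact hk (Fin.ext (hPsupp k u v (right_ne_zero_of_mul hne)).symm)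
  have hli : LinearIndependent ℝ fun k i => (P k).eval (θ i) := by
    rw [Fintype.linearIndependent_iff]
    intro g hg k
    have h0 : aeval (G.adjMatrix ℝ) (∑ k, g k • P k) = 0 := by
      refine h.aeval_eq_zero fun i => ?_
      simpa [eval_finsetSum] using congrFun hg i
    obtain ⟨u, v, huv⟩ := hPne k
    have hk := hPsupp k u v huv
    have := hentry g u v
    rw [h0] at this
    have hk' : (⟨G.dist u v, Nat.lt_succ_iff.mpr (hdist u v)⟩ : Fin (d + 1)) = k := Fin.ext hk
    rw [hk'] at this
    exact (mul_eq_zero.mp this.symm).resolve_right huv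
  have hspan : ∀ p : ℝ[X], ∃ g : Fin (d + 1) → ℝ,
      aeval (G.adjMatrix ℝ) p = aeval (G.adjMatrix ℝ) (∑ k, g k • P k) := by
    intro p
    have htop := hli.span_eq_top_of_card_eq_finrank (by simp)
    obtain ⟨g, hg⟩ := (Submodule.mem_span_range_iff_exists_fun ℝ).mp
      (htop.symm ▸ Submodule.mem_top : (fun i => p.eval (θ i)) ∈ _)
    refine ⟨g, h.aeval_congr fun i => ?_⟩
    simpa [eval_finsetSum] using (congrFun hg i).symm
  -- The polynomial on the left evaluates to the all-ones matrix.
  obtain ⟨g, hg⟩ := hspan (C (Fintype.card V : ℝ) * Lagrange.basis Finset.univ θ 0)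
  have hJ : ∀ u v, g ⟨G.dist u v, Nat.lt_succ_iff.mpr (hdist u v)⟩ *
      aeval (G.adjMatrix ℝ) (P ⟨G.dist u v, Nat.lt_succ_iff.mpr (hdist u v)⟩) u v = 1 := by
    intro u v
    rw [← hentry, ← hg, map_mul, aeval_C, ← Algebra.smul_def, Matrix.smul_apply,
      h.aeval_basis_zero_apply hconn hreg]
    simp
  refine isDistanceRegular_of_aeval hconn hdist (fun p => ?_) fun k hk => ?_
  · obtain ⟨x, hx⟩ := hspan p
    refine ⟨fun l => if hl : l < d + 1 then x ⟨l, hl⟩ / g ⟨l, hl⟩ else 0, fun u v => ?_⟩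
    beta_reduce
    rw [hx, hentry, dif_pos (show G.dist u v < d + 1 from Nat.lt_succ_iff.mpr (hdist u v)),
      eq_div_iff (left_ne_zero_of_mul_eq_one (hJ u v)), mul_assoc,
      mul_comm (aeval (G.adjMatrix ℝ) _ u v), hJ, mul_one]
  · refine ⟨∑ j, (Pi.single ⟨k, Nat.lt_succ_iff.mpr hk⟩ (g ⟨k, Nat.lt_succ_iff.mpr hk⟩) :
      Fin (d + 1) → ℝ) j • P j,
      Matrix.ext fun u v => ?_⟩
    rw [hentry, distMatrix_apply]
    split_ifs with huv
    · subst huv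
      rw [Pi.single_eq_same, hJ]
    · rw [Pi.single_eq_of_ne (fun h' => huv (Fin.ext_iff.mp h')), zero_mul]

end HasSpectrum
end SimpleGraph

/-! ### Antipodality and the distance-`d` matrix -/

/-- A reflexive symmetric relation is an equivalence relation with all classes of size `r`
exactly when its `0/1` matrix `K` satisfies `K² = rK`. -/
theorem equivalence_and_card_iff_mul_self {V : Type*} [Fintype V] {R : V → V → Prop}
    [DecidableRel R] (hrefl : ∀ u, R u u) (hsymm : ∀ u v, R u v → R v u) (r : ℕ) :
    (Equivalence R ∧ ∀ u, Nat.card {v // R u v} = r) ↔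
      (Matrix.of fun u v => if R u v then (1 : ℝ) else 0) *
        (Matrix.of fun u v => if R u v then (1 : ℝ) else 0) =
        (r : ℝ) • Matrix.of fun u v => if R u v then (1 : ℝ) else 0 := by
  have hmul : ∀ u v, ((Matrix.of fun u v => if R u v then (1 : ℝ) else 0) *
      (Matrix.of fun u v => if R u v then (1 : ℝ) else 0)) u v =
      (Finset.univ.filter fun w => R u w ∧ R w v).card := by
    intro u v
    simp only [Matrix.mul_apply, Matrix.of_apply, mul_ite, mul_one, mul_zero, ← ite_and]
    rw [Finset.sum_boole]
    simp only [and_comm]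
  have hcard : ∀ u, Nat.card {v // R u v} = (Finset.univ.filter fun w => R u w).card := by
    intro u
    rw [Nat.card_eq_fintype_card, Fintype.card_subtype]
  constructor
  · rintro ⟨heq, hr⟩
    refine Matrix.ext fun u v => ?_
    rw [hmul, Matrix.smul_apply, Matrix.of_apply]
    split_ifs with huv
    · have : (Finset.univ.filter fun w => R u w ∧ R w v) = Finset.univ.filter fun w => R u w :=
        Finset.filter_congr fun w _ =>
          and_iff_left_of_imp fun h => heq.trans (heq.symm h) huv
      rw [this, ← hcard, hr]
      simp
    · rw [Finset.filter_false_of_mem fun w _ hw => huv (heq.trans hw.1 hw.2)]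
      simp
  · intro h
    have h' : ∀ u v, ((Finset.univ.filter fun w => R u w ∧ R w v).card : ℝ) =
        r * if R u v then 1 else 0 := by
      intro u v
      rw [← hmul, h]
      rfl
    refine ⟨⟨hrefl, fun {u v} => hsymm u v, fun {u v w} huv hvw => ?_⟩, fun u => ?_⟩
    · by_contra huw
      have := h' u w
      rw [if_neg huw, mul_zero, Nat.cast_eq_zero, Finset.card_eq_zero,
        Finset.filter_eq_empty_iff] at this
      exact this (Finset.mem_univ v) ⟨huv, hvw⟩
    · have := h' u u
      rw [if_pos (hrefl u), mul_one, Nat.cast_inj] at this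
      rw [hcard, ← this]
      exact congrArg _ (Finset.filter_congr fun w _ => (and_iff_left_of_imp (hsymm u w)).symm)

namespace SimpleGraph
open Polynomial

variable {V : Type*} [Fintype V] {G : SimpleGraph V}

theorem trace_mul_distMatrix (M : Matrix V V ℝ) (d : ℕ) :
    (M * G.distMatrix d).trace = ∑ u, ∑ v, if G.dist u v = d then M u v else 0 := by
  simp only [Matrix.trace, Matrix.diag, Matrix.mul_apply, distMatrix_apply, mul_ite, mul_one,
    mul_zero]
  simp only [dist_comm]

theorem sum_sum_dist_eq_const (d : ℕ) (x : ℝ) (hV : Nonempty V) :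
    (∑ u : V, ∑ v : V, if G.dist u v = d then x else 0) =
      Fintype.card V * G.meanCardAtDist d * x := by
  rw [meanCardAtDist, mul_div_cancel₀ _ (by simp), Finset.sum_mul]
  refine Finset.sum_congr rfl fun u _ => ?_
  rw [← Finset.sum_filter, Finset.sum_const, nsmul_eq_mul]

variable [DecidableEq V]

theorem isAntipodal_iff_distMatrix {d : ℕ} (hd : 1 ≤ d) (hdiam : G.diam = d) (r : ℕ) :
    G.IsAntipodal r ↔ (G.distMatrix d + 1) * (G.distMatrix d + 1) =
      (r : ℝ) • (G.distMatrix d + 1) := by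
  have hK : (Matrix.of fun u v => if u = v ∨ G.dist u v = d then (1 : ℝ) else 0) =
      G.distMatrix d + 1 := by
    refine Matrix.ext fun u v => ?_
    rw [Matrix.of_apply, Matrix.add_apply, distMatrix_apply, Matrix.one_apply]
    by_cases huv : u = v
    · subst huv
      have : ¬ G.dist u u = d := by rw [dist_self]; omega
      simp only [true_or, if_true, if_neg this, zero_add]
    · simp [huv]
  have := equivalence_and_card_iff_mul_self (R := fun u v : V => u = v ∨ G.dist u v = d)
    (fun u => Or.inl rfl) (fun u v h => h.imp Eq.symm dist_comm.trans) r
  rw [hK] at this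
  rw [IsAntipodal, hdiam]
  exact this

theorem IsAntipodal.card_dist_eq {d r : ℕ} (hd : 1 ≤ d) (hdiam : G.diam = d)
    (h : G.IsAntipodal r) (u : V) :
    ((Finset.univ.filter fun v : V => G.dist u v = d).card : ℝ) = (r : ℝ) - 1 := by
  have hu := h.2 u
  rw [hdiam, Nat.card_eq_fintype_card, Fintype.card_subtype, Finset.filter_or,
    Finset.card_union_of_disjoint] at hu
  · rw [Finset.filter_eq, if_pos (Finset.mem_univ u), Finset.card_singleton] at hu
    rw [← hu]; push_cast; ring
  · rw [Finset.disjoint_filter]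
    rintro v - rfl h'
    rw [dist_self] at h'; omega

variable [DecidableRel G.Adj]

theorem IsDistanceRegular.aeval_apply (hG : G.IsDistanceRegular) {d : ℕ}
    (hdist : ∀ u v, G.dist u v ≤ d) (p : ℝ[X]) :
    ∃ g : ℕ → ℝ, ∀ u v, aeval (G.adjMatrix ℝ) p u v = g (G.dist u v) := by
  choose P hP using hG.2
  induction p using Polynomial.induction_on with
  | C a =>
    refine ⟨fun l => if l = 0 then a else 0, fun u v => ?_⟩
    simp only [aeval_C, Matrix.algebraMap_matrix_apply, Algebra.algebraMap_self, RingHom.id_apply,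
      hG.1.dist_eq_zero_iff]
  | add p q hp hq =>
    obtain ⟨g, hg⟩ := hp
    obtain ⟨g', hg'⟩ := hq
    exact ⟨fun l => g l + g' l, fun u v => by rw [map_add, Matrix.add_apply, hg, hg']⟩
  | monomial n a ih =>
    obtain ⟨g, hg⟩ := ih
    refine ⟨fun l => ∑ j ∈ Finset.range (d + 1), P l 1 j * g j, fun u v => ?_⟩
    rw [pow_succ, ← mul_assoc, mul_comm, map_mul, aeval_X, Matrix.mul_apply]
    have hsum : ∀ w, G.adjMatrix ℝ u w * aeval (G.adjMatrix ℝ) (C a * X ^ n) w v =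
        ∑ j ∈ Finset.range (d + 1), if G.dist u w = 1 ∧ G.dist v w = j then g j else 0 := by
      intro w
      have hmem : G.dist v w ∈ Finset.range (d + 1) :=
        Finset.mem_range.mpr (Nat.lt_succ_iff.mpr (hdist v w))
      rw [hg, adjMatrix_apply, G.dist_comm (u := w)]
      by_cases hadj : G.Adj u w
      · simp only [hadj, dist_eq_one_iff_adj, true_and, if_true, Finset.sum_ite_eq, hmem, one_mul]
      · simp [hadj, dist_eq_one_iff_adj]
    rw [Finset.sum_congr rfl fun w _ => hsum w, Finset.sum_comm]
    refine Finset.sum_congr rfl fun j _ => ?_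
    rw [← Finset.sum_filter, Finset.sum_const, hP _ 1 j u v rfl, nsmul_eq_mul]

namespace HasSpectrum
variable {d : ℕ} {θ : Fin (d + 1) → ℝ} {m : Fin (d + 1) → ℕ}

/-- In a distance-regular graph with `d + 1` distinct eigenvalues and diameter at most `d`, the
adjacency algebra lies in the space of matrices whose entries depend only on the distance, and has
at least its dimension. -/
theorem exists_aeval_eq_distMatrix (h : G.HasSpectrum θ m) (hG : G.IsDistanceRegular)
    (hdist : ∀ u v, G.dist u v ≤ d) (k : ℕ) :
    ∃ p : ℝ[X], aeval (G.adjMatrix ℝ) p = G.distMatrix k := by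
  let ψ : (Fin (d + 1) → ℝ) →ₗ[ℝ] Matrix V V ℝ :=
    (aeval (G.adjMatrix ℝ)).toLinearMap ∘ₗ Lagrange.interpolate Finset.univ θ
  let φ : (Fin (d + 1) → ℝ) →ₗ[ℝ] Matrix V V ℝ :=
    { toFun := fun f => Matrix.of fun u v => f ⟨G.dist u v, Nat.lt_succ_iff.mpr (hdist u v)⟩
      map_add' := fun _ _ => rfl
      map_smul' := fun _ _ => rfl }
  have hinj : Function.Injective ψ := by
    intro f g hfg
    funext i
    have := h.eval_eq_of_aeval_eq hfg i
    rwa [Lagrange.eval_interpolate_at_node _ h.injOn (Finset.mem_univ i),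
      Lagrange.eval_interpolate_at_node _ h.injOn (Finset.mem_univ i)] at this
  have hle : LinearMap.range ψ ≤ LinearMap.range φ := by
    rintro _ ⟨f, rfl⟩
    obtain ⟨g, hg⟩ := hG.aeval_apply hdist (Lagrange.interpolate Finset.univ θ f)
    exact ⟨fun l => g l, Matrix.ext fun u v => (hg u v).symm⟩
  have heq : LinearMap.range ψ = LinearMap.range φ :=
    Submodule.eq_of_le_of_finrank_le hle
      ((LinearMap.finrank_range_le φ).trans (LinearMap.finrank_range_of_inj hinj).ge)
  have hmem : G.distMatrix k ∈ LinearMap.range φ :=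
    ⟨fun l => if (l : ℕ) = k then 1 else 0, rfl⟩
  rw [← heq] at hmem
  obtain ⟨f, hf⟩ := hmem
  exact ⟨Lagrange.interpolate Finset.univ θ f, hf⟩

/-- If `A_d` is the value of a polynomial `p` in the adjacency matrix, then the eigenvalues `p(θ_i)`
of `A_d` are obtained from the entries of the principal idempotents. -/
theorem mult_mul_eval_of_aeval_eq_distMatrix (h : G.HasSpectrum θ m) (hconn : G.Connected)
    (hreg : ∀ u v : V, G.degree u = G.degree v) {p : ℝ[X]}
    (hp : aeval (G.adjMatrix ℝ) p = G.distMatrix d) (i : Fin (d + 1)) :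
    m i * p.eval (θ i) = (-1) ^ (i : ℕ) * G.meanCardAtDist d *
      (eigenvalueGapProd θ 0 / eigenvalueGapProd θ i) := by
  have hV := hconn.nonempty
  rw [← h.trace_aeval_basis_mul, map_mul, hp, trace_mul_distMatrix]
  have : ∀ u v, (if G.dist u v = d then
      aeval (G.adjMatrix ℝ) (Lagrange.basis Finset.univ θ i) u v else 0) =
      if G.dist u v = d then (-1) ^ (i : ℕ) *
        (eigenvalueGapProd θ 0 / eigenvalueGapProd θ i) / Fintype.card V else 0 := by
    intro u v
    split_ifs with huv
    · exact h.aeval_basis_apply_of_dist_eq hconn hreg i huv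
    · rfl
  simp only [this]
  rw [sum_sum_dist_eq_const _ _ hV]
  have : (Fintype.card V : ℝ) ≠ 0 := by simp
  field_simp

/-- In an `r`-antipodal distance-regular graph the eigenvalues of `A_d` are `r - 1` and `-1`, and
the sign of `E_i` at distance `d` tells which of them belongs to `θ i`. -/
theorem mult_eq_of_isAntipodal (h : G.HasSpectrum θ m) (hd : 1 ≤ d) (hdiam : G.diam = d)
    (hdist : ∀ u v, G.dist u v ≤ d) (hreg : ∀ u v : V, G.degree u = G.degree v) {r : ℕ}
    (hr : 2 ≤ r) (hG : G.IsDistanceRegular) (hA : G.IsAntipodal r) (i : Fin (d + 1)) :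
    (m i : ℝ) = (if Even (i : ℕ) then 1 else (r : ℝ) - 1) *
      (eigenvalueGapProd θ 0 / eigenvalueGapProd θ i) := by
  have hV := hG.1.nonempty
  have hmean : G.meanCardAtDist d = (r : ℝ) - 1 := by
    rw [meanCardAtDist, div_eq_iff (by simp)]
    simp only [hA.card_dist_eq hd hdiam, Finset.sum_const, Finset.card_univ, nsmul_eq_mul]
    ring
  obtain ⟨p, hp⟩ := h.exists_aeval_eq_distMatrix hG hdist d
  have hroot : (p.eval (θ i) + 1) * (p.eval (θ i) + 1) = r * (p.eval (θ i) + 1) := by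
    have : aeval (G.adjMatrix ℝ) ((p + 1) * (p + 1)) =
        aeval (G.adjMatrix ℝ) (C (r : ℝ) * (p + 1)) := by
      rw [map_mul, map_mul, map_add, hp, map_one, (isAntipodal_iff_distMatrix hd hdiam r).mp hA,
        aeval_C, ← Algebra.smul_def]
    simpa using h.eval_eq_of_aeval_eq this i
  have hmul := h.mult_mul_eval_of_aeval_eq_distMatrix hG.1 hreg hp i
  rw [hmean] at hmul
  have hr' : (2 : ℝ) ≤ r := by exact_mod_cast hr
  have hm : (0 : ℝ) < m i := by exact_mod_cast h.mult_pos i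
  set b := eigenvalueGapProd θ 0 / eigenvalueGapProd θ i with hb
  have hbpos : 0 < b :=
    div_pos (eigenvalueGapProd_pos h.strictAnti 0) (eigenvalueGapProd_pos h.strictAnti i)
  have hrb : 0 < ((r : ℝ) - 1) * b := mul_pos (by linarith) hbpos
  have hroot' : p.eval (θ i) = -1 ∨ p.eval (θ i) = r - 1 := by
    have : (p.eval (θ i) + 1) * (p.eval (θ i) - (r - 1)) = 0 := by linarith
    rcases mul_eq_zero.mp this with h1 | h1
    · left; linarith
    · right; linarith
  split_ifs with hi
  · rw [hi.neg_one_pow] at hmul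
    rcases hroot' with h1 | h1 <;> rw [h1] at hmul
    · linarith
    · have : ((r : ℝ) - 1) ≠ 0 := by linarith
      apply mul_right_cancel₀ this
      linarith
  · rw [(Nat.not_even_iff_odd.mp hi).neg_one_pow] at hmul
    rcases hroot' with h1 | h1 <;> rw [h1] at hmul
    · linarith
    · have := mul_pos hm (by linarith : (0 : ℝ) < r - 1)
      linarith

/-! ### The case of equality -/

/-- If the multiplicities are the ones prescribed by equality, then `A_d` is the polynomial in the
adjacency matrix taking the values `r - 1` and `-1` alternately on the eigenvalues. -/
theorem aeval_interpolate_eq_distMatrix (h : G.HasSpectrum θ m) (hconn : G.Connected)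
    (hd : 1 ≤ d) (hreg : ∀ u v : V, G.degree u = G.degree v) {u₀ v₀ : V}
    (huv₀ : G.dist u₀ v₀ = d) {r : ℝ} (hr : r - 1 ≠ 0)
    (hmean : G.meanCardAtDist d = r - 1)
    (hm : ∀ i, (m i : ℝ) = (if Even (i : ℕ) then 1 else r - 1) *
      (eigenvalueGapProd θ 0 / eigenvalueGapProd θ i)) :
    aeval (G.adjMatrix ℝ) (Lagrange.interpolate Finset.univ θ
      fun i => if Even (i : ℕ) then r - 1 else -1) = G.distMatrix d := by
  have hV := hconn.nonempty
  have hn : (Fintype.card V : ℝ) ≠ 0 := by simp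
  set c : Fin (d + 1) → ℝ := fun i => if Even (i : ℕ) then r - 1 else -1 with hc
  set P := aeval (G.adjMatrix ℝ) (Lagrange.interpolate Finset.univ θ c) with hP
  have hceval : ∀ i, (Lagrange.interpolate Finset.univ θ c).eval (θ i) = c i := fun i =>
    Lagrange.eval_interpolate_at_node c h.injOn (Finset.mem_univ i)
  have hcm : ∀ i, c i * m i = (r - 1) *
      ((-1) ^ (i : ℕ) * (eigenvalueGapProd θ 0 / eigenvalueGapProd θ i)) := by
    intro i
    rw [hm i, hc]
    by_cases hi : Even (i : ℕ)
    · simp [hi, hi.neg_one_pow]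
    · simp [hi, (Nat.not_even_iff_odd.mp hi).neg_one_pow]
  have hcm_entry : ∀ u v, G.dist u v = d → ∀ i, c i * m i = (r - 1) * (Fintype.card V *
      aeval (G.adjMatrix ℝ) (Lagrange.basis Finset.univ θ i) u v) := by
    intro u v huv i
    rw [hcm, h.aeval_basis_apply_of_dist_eq hconn hreg i huv, mul_div_cancel₀ _ hn]
  -- The entries of `∑ E_i = I` at distance `d` vanish.
  have hsum1 : ∑ i, c i * m i = 0 := by
    have h1 : aeval (G.adjMatrix ℝ) (∑ i, Lagrange.basis Finset.univ θ i) u₀ v₀ = 0 := by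
      rw [Lagrange.sum_basis h.injOn Finset.univ_nonempty, map_one, Matrix.one_apply_ne]
      rintro rfl
      rw [dist_self] at huv₀
      omega
    rw [map_sum, Matrix.sum_apply] at h1
    rw [Finset.sum_congr rfl fun i _ => hcm_entry u₀ v₀ huv₀ i, ← Finset.mul_sum, ← Finset.mul_sum,
      h1, mul_zero, mul_zero]
  have hsum0 : ∑ i, (m i : ℝ) = Fintype.card V := by
    have := h.trace_aeval 1
    simpa [Matrix.trace_one] using this.symm
  have hsum2 : ∑ i, c i * (c i * m i) = Fintype.card V * (r - 1) := by
    -- The values `r - 1` and `-1` of `c` are the roots of `x² = (r - 2) x + (r - 1)`.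
    have hquad : ∀ i, c i * (c i * m i) = (r - 2) * (c i * m i) + (r - 1) * m i := by
      intro i
      rw [hc]
      dsimp only
      split_ifs <;> ring
    rw [Finset.sum_congr rfl fun i _ => hquad i, Finset.sum_add_distrib, ← Finset.mul_sum,
      ← Finset.mul_sum, hsum1, hsum0]
    ring
  have hPd : ∀ u v, G.dist u v = d → P u v = 1 := by
    intro u v huv
    have h1 : P u v = ∑ i, c i * aeval (G.adjMatrix ℝ) (Lagrange.basis Finset.univ θ i) u v := by
      rw [hP, Lagrange.interpolate_apply, map_sum, Matrix.sum_apply]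
      refine Finset.sum_congr rfl fun i _ => ?_
      rw [map_mul, aeval_C, ← Algebra.smul_def, Matrix.smul_apply, smul_eq_mul]
    have h2 : (r - 1) * Fintype.card V * P u v = Fintype.card V * (r - 1) := by
      rw [h1, ← hsum2, Finset.mul_sum]
      refine Finset.sum_congr rfl fun i _ => ?_
      rw [hcm_entry u v huv i]
      ring
    apply mul_left_cancel₀ (mul_ne_zero hr hn)
    rw [h2]; ring
  have htr : ∑ u, ∑ v, P u v * P u v = Fintype.card V * (r - 1) := by
    have h1 := h.trace_aeval
      (Lagrange.interpolate Finset.univ θ c * Lagrange.interpolate Finset.univ θ c)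
    simp only [eval_mul, hceval] at h1
    rw [map_mul, ← hP] at h1
    rw [← hsum2]
    calc _ = (P * P).trace := by
          simp only [Matrix.trace, Matrix.diag, Matrix.mul_apply]
          refine Finset.sum_congr rfl fun u _ => Finset.sum_congr rfl fun v _ => ?_
          rw [hP, aeval_adjMatrix_comm _ v u]
      _ = _ := by
          rw [h1]
          exact Finset.sum_congr rfl fun i _ => by ring
  -- `P` and `A_d` agree at distance `d` and have the same norm, so `‖P - A_d‖ = 0`.
  have hnorm : ∑ u, ∑ v, (P u v - G.distMatrix d u v) ^ 2 = 0 := by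
    have h1 : ∀ u v, (P u v - G.distMatrix d u v) ^ 2 =
        P u v * P u v - if G.dist u v = d then 1 else 0 := by
      intro u v
      rw [distMatrix_apply]
      split_ifs with huv
      · rw [hPd u v huv]; ring
      · ring
    simp only [h1, Finset.sum_sub_distrib]
    rw [htr, sum_sum_dist_eq_const _ _ hV, hmean]
    ring
  refine Matrix.ext fun u v => ?_
  have h1 := (Finset.sum_eq_zero_iff_of_nonneg fun u _ => Finset.sum_nonneg fun v _ =>
    sq_nonneg _).mp hnorm u (Finset.mem_univ u)
  have h2 := (Finset.sum_eq_zero_iff_of_nonneg fun v _ => sq_nonneg _).mp h1 v (Finset.mem_univ v)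
  exact sub_eq_zero.mp (pow_eq_zero_iff two_ne_zero |>.mp h2)

theorem isDistanceRegular_and_isAntipodal_of_mult_eq (h : G.HasSpectrum θ m) (hconn : G.Connected)
    (hd : 1 ≤ d) (hdiam : G.diam = d) (hdist : ∀ u v, G.dist u v ≤ d)
    (hreg : ∀ u v : V, G.degree u = G.degree v) {r : ℕ} (hr : 2 ≤ r)
    (hmean : G.meanCardAtDist d = (r : ℝ) - 1)
    (hm : ∀ i, (m i : ℝ) = (if Even (i : ℕ) then 1 else (r : ℝ) - 1) *
      (eigenvalueGapProd θ 0 / eigenvalueGapProd θ i)) :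
    G.IsDistanceRegular ∧ G.IsAntipodal r := by
  have hV := hconn.nonempty
  have hr' : (2 : ℝ) ≤ r := by exact_mod_cast hr
  have hr0 : (r : ℝ) - 1 ≠ 0 := by linarith
  obtain ⟨u₀, v₀, huv₀⟩ := G.exists_dist_eq_diam
  rw [hdiam] at huv₀
  have hP := h.aeval_interpolate_eq_distMatrix hconn hd hreg huv₀ hr0 hmean hm
  set s := Lagrange.interpolate Finset.univ θ
    fun i : Fin (d + 1) => if Even (i : ℕ) then (r : ℝ) - 1 else -1
  have hs : ∀ i, s.eval (θ i) = if Even (i : ℕ) then (r : ℝ) - 1 else -1 := fun i =>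
    Lagrange.eval_interpolate_at_node _ h.injOn (Finset.mem_univ i)
  refine ⟨h.isDistanceRegular_of_aeval_eq_distMatrix hconn hreg hdist hP fun i => ?_,
    (isAntipodal_iff_distMatrix hd hdiam r).mpr ?_⟩
  · rw [hs]
    split_ifs
    · exact hr0
    · norm_num
  · have : aeval (G.adjMatrix ℝ) ((s + 1) * (s + 1)) =
        aeval (G.adjMatrix ℝ) (C (r : ℝ) * (s + 1)) := by
      refine h.aeval_congr fun i => ?_
      rw [eval_mul, eval_mul, eval_C, eval_add, eval_one, hs]
      split_ifs <;> ring
    rwa [map_mul, map_mul, map_add, hP, map_one, aeval_C, ← Algebra.smul_def] at this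

end HasSpectrum
end SimpleGraph

theorem proposition4p7 {V : Type*} [Fintype V] [DecidableEq V]
    (G : SimpleGraph V) [DecidableRel G.Adj] (hconn : G.Connected) (hwalk : G.IsWalkRegular)
    (d : ℕ) (hd : 1 ≤ d) (θ : Fin (d + 1) → ℝ) (m : Fin (d + 1) → ℕ)
    (hspec : G.HasSpectrum θ m) (hdiam : G.diam = d)
    (r : ℕ) (hr : G.kIndepNum (d - 1) = r) :
    (∀ i : ℕ, 1 ≤ i →
      (∀ h : 2 * i < d + 1,
        eigenvalueGapProd θ 0 / eigenvalueGapProd θ ⟨2 * i, h⟩ ≤ (m ⟨2 * i, h⟩ : ℝ)) ∧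
      (∀ h : 2 * i - 1 < d + 1,
        ((r : ℝ) - 1) * (eigenvalueGapProd θ 0 / eigenvalueGapProd θ ⟨2 * i - 1, h⟩)
          ≤ (m ⟨2 * i - 1, h⟩ : ℝ))) ∧
    (G.meanCardAtDist d = (r : ℝ) - 1 →
      ((∀ i : ℕ, 1 ≤ i →
        (∀ h : 2 * i < d + 1,
          (m ⟨2 * i, h⟩ : ℝ) = eigenvalueGapProd θ 0 / eigenvalueGapProd θ ⟨2 * i, h⟩) ∧
        (∀ h : 2 * i - 1 < d + 1,
          (m ⟨2 * i - 1, h⟩ : ℝ)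
            = ((r : ℝ) - 1) * (eigenvalueGapProd θ 0 / eigenvalueGapProd θ ⟨2 * i - 1, h⟩))) ↔
      (G.IsDistanceRegular ∧ G.IsAntipodal r))) := by
  have hV := hconn.nonempty
  obtain ⟨u₀, v₀, huv₀⟩ := G.exists_dist_eq_diam
  rw [hdiam] at huv₀
  obtain ⟨S, hS, hSr, hS2⟩ := SimpleGraph.exists_finset_dist_eq_of_kIndepNum hconn hd hdiam
  rw [hr] at hSr
  have hr2 : 2 ≤ r := hSr ▸ hS2
  have hdist : ∀ u v, G.dist u v ≤ d := by
    intro u v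
    rw [← hdiam]
    refine SimpleGraph.dist_le_diam fun htop => ?_
    rw [SimpleGraph.diam, htop, ENat.toNat_top] at hdiam
    omega
  have hodd : ∀ i : ℕ, 1 ≤ i → Odd (2 * i - 1) := fun i hi => ⟨i - 1, by omega⟩
  refine ⟨fun i hi => ⟨fun h => ?_, fun h => ?_⟩, fun hmean => ⟨fun heq => ?_, ?_⟩⟩
  · exact hspec.div_le_mult_of_even hconn hwalk hd huv₀ (even_two_mul i)
  · rw [← hSr]
    exact hspec.mul_div_le_mult_of_odd hconn hwalk hS (Finset.card_pos.mp (by omega)) (hodd i hi)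
  · refine hspec.isDistanceRegular_and_isAntipodal_of_mult_eq hconn hd hdiam hdist hwalk.degree_eq
      hr2 hmean fun ⟨j, hj⟩ => ?_
    rcases Nat.even_or_odd' j with ⟨i, rfl | rfl⟩
    · rw [if_pos (even_two_mul i), one_mul]
      rcases Nat.eq_zero_or_pos i with rfl | hi
      -- The index `0` is not among the hypotheses: there, both sides equal `1`.
      · have h0 := hspec.mult_zero hconn hwalk.degree_eq
        have hπ := (eigenvalueGapProd_pos hspec.strictAnti 0).ne'
        change ((m 0 : ℕ) : ℝ) = eigenvalueGapProd θ 0 / eigenvalueGapProd θ 0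
        rw [h0, div_self hπ, Nat.cast_one]
      · exact (heq i hi).1 hj
    · rw [if_neg (by simp)]
      exact (heq (i + 1) (by omega)).2 hj
  · rintro ⟨hG, hA⟩ i hi
    have key := hspec.mult_eq_of_isAntipodal hd hdiam hdist hwalk.degree_eq hr2 hG hA
    refine ⟨fun h => ?_, fun h => ?_⟩
    · simpa using key ⟨2 * i, h⟩
    · have := key ⟨2 * i - 1, h⟩
      rwa [if_neg (Nat.not_even_iff_odd.mpr (hodd i hi))] at this
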